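/- Let $\overline{\mathbb{Q}}\subset\mathbb{C}$ be the field of algebraic numbers. A function $f\colon\mathbb{Z}_{\ge 1}\to\mathbb{C}$ is called an algebraic function over a subfield $K\subseteq\mathbb{C}$ if there exist an integer $k\ge 0$ and polynomials $q_0,\dots,q_k\in K[x]$ with $q_k$ not the zero polynomial such that $$q_k(n)f(n)^k+q_{k-1}(n)f(n)^{k-1}+\cdots+q_1(n)f(n)+q_0(n)=0\quad\text{for all integers } n\ge 1;$$ otherwise $f$ is called a transcendental function over $K$. Then the function $$U(n)=\sum_{j=1}^{n}\frac{1}{j^2}\qquad(n\ge 1)$$ is a transcendental function of $n$ over $\overline{\mathbb{Q}}$. -/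

import Mathlib

open Polynomial

/-- A complex-valued function `f` of one positive integer variable is an algebraic function over a
subfield `K` of `ℂ` if there are polynomials `q 0, …, q k` with coefficients in `K`, with `q k` a
nonzero polynomial, such that `∑ i ≤ k, q i (n) * f n ^ i = 0` for every positive integer `n`. -/
def IsAlgebraicFunction (K : Subfield ℂ) (f : ℕ+ → ℂ) : Prop :=
  ∃ (k : ℕ) (q : ℕ → K[X]), q k ≠ 0 ∧
    ∀ n : ℕ+, ∑ i ∈ Finset.range (k + 1), aeval ((n : ℕ) : ℂ) (q i) * f n ^ i = 0

/-- A function of one positive integer variable is transcendental over `K` if it is not algebraic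
over `K`. -/
def IsTranscendentalFunction (K : Subfield ℂ) (f : ℕ+ → ℂ) : Prop :=
  ¬ IsAlgebraicFunction K f

/-- The field of algebraic numbers, as a subfield of `ℂ`. -/
noncomputable def algebraicNumbers : Subfield ℂ :=
  (algebraicClosure ℚ ℂ).toSubfield

/-- The partial sums `U n = ∑_{j = 1}^n 1 / j ^ 2`. -/
noncomputable def baselPartialSum (n : ℕ+) : ℂ :=
  ∑ j ∈ Finset.Icc 1 (n : ℕ), 1 / (j : ℂ) ^ 2

/-!
The partial sums `U n = ∑_{j ≤ n} 1 / j ^ 2` satisfy no nontrivial polynomial relation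
`P (n, U n) = 0`, even over `ℂ`.

Consider a nonzero `P ∈ ℂ[x][y]` of least degree `k` in `y` with `P (n, U n) = 0` for all `n ≥ 1`.
Since `U (n + 1) = U n + 1 / (n + 1) ^ 2`, the pair `(n, U n)` also annihilates
`P (x + 1, y + 1 / (x + 1) ^ 2)`. Clearing denominators and eliminating `y ^ k` between this
relation and `P` gives a relation of smaller degree (`shiftElim`), which has to vanish
identically. Its coefficient at `y ^ (k - 1)` says that `r = p / q`, where `p` and `q` are the
coefficients of `P` at `y ^ (k - 1)` and `y ^ k`, satisfies the difference equation
`r (x + 1) - r x = -k / (x + 1) ^ 2`. No rational function does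
(`shift_sub_ne_const_div_sq`): a pole of `r` exists at `-1` or at `0`, and the equation carries it
to all of `-1, -2, …` or to all of `0, 1, …`.
-/

/-! ### The difference equation has no rational solution -/

/-- A polynomial vanishing at `b + s m` for all natural `m`, where `s ≠ 0`, is zero. -/
lemma eq_zero_of_eval_arithmetic_progression {F : Type*} [Field F] [CharZero F] {q : F[X]}
    (b s : F) (hs : s ≠ 0) (h : ∀ m : ℕ, q.eval (b + s * m) = 0) : q = 0 := by
  refine eq_zero_of_infinite_isRoot q (Set.Infinite.mono (s := Set.range fun m : ℕ => b + s * m)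
    ?_ (Set.infinite_range_of_injective ?_))
  · rintro _ ⟨m, rfl⟩
    exact h m
  · intro m m' hm
    simpa [hs] using hm

/-- The case of `shift_sub_ne_const_div_sq` in which the fraction `p / q` is reduced. -/
lemma shift_sub_ne_const_div_sq_of_isCoprime {F : Type*} [Field F] [CharZero F] {p q : F[X]}
    {c : F} (hc : c ≠ 0) (hq : q ≠ 0) (hpq : IsCoprime p q) :
    (X + 1) ^ 2 * (q * p.comp (X + 1) - q.comp (X + 1) * p) ≠ C c * (q * q.comp (X + 1)) := by
  intro h
  have key (x : F) : (x + 1) ^ 2 * (q.eval x * p.eval (x + 1) - q.eval (x + 1) * p.eval x) =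
      c * (q.eval x * q.eval (x + 1)) := by
    simpa using congrArg (eval x) h
  have hp {x : F} (hx : q.eval x = 0) : p.eval x ≠ 0 := by
    intro hx'
    obtain ⟨u, v, huv⟩ := hpq
    simpa [hx, hx'] using congrArg (eval x) huv
  by_cases h1 : q.eval (-1) = 0
  · refine hq (eq_zero_of_eval_arithmetic_progression (-1) (-1) (by simp) fun m => ?_)
    induction m with
    | zero => simpa using h1
    | succ m ih =>
      have hk := key (-1 + -1 * ((m + 1 : ℕ) : F))
      have e : (-1 + -1 * ((m + 1 : ℕ) : F)) + 1 = -1 + -1 * (m : F) := by push_cast; ring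
      have e0 : -1 + -1 * (m : F) ≠ 0 := by
        rw [show -1 + -1 * (m : F) = -((m + 1 : ℕ) : F) by push_cast; ring]
        exact neg_ne_zero.2 (Nat.cast_ne_zero.2 m.succ_ne_zero)
      simpa only [e, ih, zero_mul, mul_zero, sub_zero, mul_eq_zero, pow_eq_zero_iff two_ne_zero,
        e0, hp ih, false_or, or_false] using hk
  · -- At `x = -1` the left-hand side vanishes, so `q` has its root at `0`.
    have h0 : q.eval 0 = 0 := by
      have := key (-1)
      simpa [hc, h1] using this
    refine hq (eq_zero_of_eval_arithmetic_progression 0 1 one_ne_zero fun m => ?_)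
    induction m with
    | zero => simpa using h0
    | succ m ih =>
      rw [zero_add, one_mul] at ih ⊢
      have hk := key m
      have e0 : (m : F) + 1 ≠ 0 := by exact_mod_cast m.succ_ne_zero
      rw [ih] at hk
      push_cast
      simpa [e0, hp ih] using hk

/-- No rational function `p / q` satisfies `r (x + 1) - r x = c / (x + 1) ^ 2` with `c ≠ 0`; the
equation is stated with denominators cleared. -/
lemma shift_sub_ne_const_div_sq {F : Type*} [Field F] [CharZero F] {p q : F[X]}
    {c : F} (hc : c ≠ 0) (hq : q ≠ 0) :
    (X + 1) ^ 2 * (q * p.comp (X + 1) - q.comp (X + 1) * p) ≠ C c * (q * q.comp (X + 1)) := by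
  classical
  intro h
  have hg : EuclideanDomain.gcd p q ≠ 0 := fun h0 => hq (EuclideanDomain.gcd_eq_zero_iff.1 h0).2
  obtain ⟨p', hp'⟩ := EuclideanDomain.gcd_dvd_left p q
  obtain ⟨q', hq'⟩ := EuclideanDomain.gcd_dvd_right p q
  have hcop : IsCoprime p' q' := by
    obtain ⟨u, v, huv⟩ : ∃ u v, EuclideanDomain.gcd p q = p * u + q * v :=
      ⟨_, _, EuclideanDomain.gcd_eq_gcd_ab p q⟩
    refine ⟨u, v, mul_left_cancel₀ hg ?_⟩
    linear_combination -huv - u * hp' - v * hq'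
  generalize EuclideanDomain.gcd p q = g at hg hp' hq'
  subst hp' hq'
  have hg1 : g.comp (X + 1) ≠ 0 := by
    rw [← map_one C]
    exact fun h0 => hg ((comp_X_add_C_eq_zero_iff).1 h0)
  refine shift_sub_ne_const_div_sq_of_isCoprime hc (right_ne_zero_of_mul hq) hcop
    (mul_left_cancel₀ (mul_ne_zero hg hg1) ?_)
  simp only [mul_comp] at h
  linear_combination h

/-! ### Elimination of the leading term -/

/-- For `P ∈ F[x][y]`, the polynomial `(x + 1) ^ (2 k) * P (x + 1, y + 1 / (x + 1) ^ 2)`, where `k`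
is the degree of `P` in `y`. -/
noncomputable def shiftClear {F : Type*} [Field F] (P : F[X][X]) : F[X][X] :=
  ∑ i ∈ Finset.range (P.natDegree + 1),
    C ((P.coeff i).comp (X + 1) * ((X + 1) ^ 2) ^ (P.natDegree - i)) *
      (C ((X + 1) ^ 2) * X + 1) ^ i

/-- The combination of `P` and `shiftClear P` in which the top power of `y` cancels. -/
noncomputable def shiftElim {F : Type*} [Field F] (P : F[X][X]) : F[X][X] :=
  C P.leadingCoeff * shiftClear P -
    C (P.leadingCoeff.comp (X + 1) * ((X + 1) ^ 2) ^ P.natDegree) * P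

lemma coeff_C_mul_X_add_one_pow {R : Type*} [CommRing R] (d : R) (i j : ℕ) :
    ((C d * X + 1) ^ i).coeff j = i.choose j * d ^ j := by
  rw [show (C d * X + 1) ^ i = ((X + 1) ^ i : R[X]).comp (C d * X) by simp,
    comp_C_mul_X_coeff, coeff_X_add_one_pow]

lemma coeff_shiftClear {F : Type*} [Field F] (P : F[X][X]) (j : ℕ) :
    (shiftClear P).coeff j = ∑ i ∈ Finset.range (P.natDegree + 1),
      (P.coeff i).comp (X + 1) * ((X + 1) ^ 2) ^ (P.natDegree - i) *
        ((i.choose j : F[X]) * ((X + 1) ^ 2) ^ j) := by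
  simp only [shiftClear, finsetSum_coeff, coeff_C_mul, coeff_C_mul_X_add_one_pow]

lemma coeff_natDegree_shiftClear {F : Type*} [Field F] (P : F[X][X]) :
    (shiftClear P).coeff P.natDegree =
      P.leadingCoeff.comp (X + 1) * ((X + 1) ^ 2) ^ P.natDegree := by
  rw [coeff_shiftClear, Finset.sum_range_succ, Finset.sum_eq_zero]
  · simp
  · intro i hi
    simp [Nat.choose_eq_zero_of_lt (Finset.mem_range.1 hi)]

lemma coeff_shiftClear_of_natDegree_eq_succ {F : Type*} [Field F] {P : F[X][X]} {k : ℕ}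
    (hk : P.natDegree = k + 1) :
    (shiftClear P).coeff k = ((X + 1) ^ 2) ^ k *
      ((P.coeff k).comp (X + 1) * (X + 1) ^ 2 + ((k : F[X]) + 1) * P.leadingCoeff.comp (X + 1)) := by
  rw [coeff_shiftClear, leadingCoeff, hk, Finset.sum_range_succ, Finset.sum_range_succ,
    Finset.sum_eq_zero]
  · simp
    ring
  · intro i hi
    simp [Nat.choose_eq_zero_of_lt (Finset.mem_range.1 hi)]

lemma degree_shiftElim_lt {F : Type*} [Field F] (P : F[X][X]) :
    (shiftElim P).degree < P.natDegree := by
  refine (degree_lt_iff_coeff_zero _ _).2 fun j hj => ?_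
  rcases hj.eq_or_lt with rfl | hj
  · rw [shiftElim, coeff_sub, coeff_C_mul, coeff_C_mul, coeff_natDegree_shiftClear, leadingCoeff]
    ring
  · rw [shiftElim, coeff_sub, coeff_C_mul, coeff_C_mul, coeff_eq_zero_of_natDegree_lt hj,
      coeff_shiftClear, Finset.sum_eq_zero]
    · simp
    · intro i hi
      have : i < j := lt_of_le_of_lt (Nat.lt_succ_iff.1 (Finset.mem_range.1 hi)) hj
      simp [Nat.choose_eq_zero_of_lt this]

/-- The coefficient of `shiftElim P` one below the degree of `P` is a nonzero multiple of the
difference equation for the quotient of the two top coefficients of `P`. -/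
lemma shiftElim_ne_zero {F : Type*} [Field F] [CharZero F] {P : F[X][X]}
    (hP : P.natDegree ≠ 0) : shiftElim P ≠ 0 := by
  intro h
  obtain ⟨k, hk⟩ := Nat.exists_eq_succ_of_ne_zero hP
  have hlead : P.leadingCoeff ≠ 0 := by
    rintro h0
    simp [leadingCoeff_eq_zero.1 h0] at hP
  have hc : -((k + 1 : ℕ) : F) ≠ 0 := neg_ne_zero.2 (Nat.cast_ne_zero.2 k.succ_ne_zero)
  refine shift_sub_ne_const_div_sq (p := P.coeff k) hc hlead ?_
  have hX : (((X : F[X]) + 1) ^ 2) ^ k ≠ 0 := pow_ne_zero _ (pow_ne_zero _ (X_add_C_ne_zero 1))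
  have hcoeff := congrArg (fun Q => Q.coeff k) h
  simp only [shiftElim, coeff_sub, coeff_C_mul, coeff_shiftClear_of_natDegree_eq_succ hk,
    coeff_zero, hk, Nat.succ_eq_add_one, pow_succ _ k] at hcoeff
  refine mul_left_cancel₀ hX ?_
  rw [map_neg, map_natCast]
  push_cast
  linear_combination hcoeff

/-! ### Polynomial relations along a sequence -/

lemma evalEval_shiftClear {F : Type*} [Field F] (P : F[X][X]) {x y z : F} (hx : x + 1 ≠ 0)
    (hz : z = y + 1 / (x + 1) ^ 2) :
    (shiftClear P).evalEval x y = ((x + 1) ^ 2) ^ P.natDegree * P.evalEval (x + 1) z := by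
  have hP : P.evalEval (x + 1) z =
      ∑ i ∈ Finset.range (P.natDegree + 1), (P.coeff i).eval (x + 1) * z ^ i := by
    rw [evalEval, eval_eq_sum_range (p := P), eval_finsetSum]
    simp
  rw [hP, Finset.mul_sum, shiftClear, evalEval_finsetSum]
  refine Finset.sum_congr rfl fun i hi => ?_
  have hi' : i ≤ P.natDegree := Nat.lt_succ_iff.1 (Finset.mem_range.1 hi)
  have hd : (x + 1) ^ 2 * y + 1 = (x + 1) ^ 2 * z := by
    rw [hz]
    field_simp
  have hev : (C ((X + 1) ^ 2) * X + 1 : F[X][X]).evalEval x y = (x + 1) ^ 2 * z := by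
    rw [← hd]
    simp [evalEval]
  rw [evalEval_mul, evalEval_pow, hev, evalEval_C, mul_pow, ← Nat.sub_add_cancel hi', pow_add,
    Nat.sub_add_cancel hi']
  simp only [eval_mul, eval_comp, eval_pow, eval_add, eval_X, eval_one]
  ring

/-- A sequence with `u (n + 1) = u n + 1 / (n + 1) ^ 2` satisfies no nontrivial polynomial relation
with `n`. -/
theorem eq_zero_of_evalEval_eq_zero {F : Type*} [Field F] [CharZero F] {u : ℕ → F}
    (hu : ∀ n : ℕ, u (n + 1) = u n + 1 / ((n : F) + 1) ^ 2) (P : F[X][X])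
    (hP : ∀ n : ℕ, 1 ≤ n → P.evalEval (n : F) (u n) = 0) : P = 0 := by
  induction hk : P.natDegree using Nat.strong_induction_on generalizing P with
  | _ k ih =>
    subst hk
    by_cases h0 : P.natDegree = 0
    · rw [eq_C_of_natDegree_eq_zero h0] at hP ⊢
      simp only [evalEval_C] at hP
      refine (congrArg C (eq_zero_of_eval_arithmetic_progression 1 1 one_ne_zero fun m => ?_)).trans
        (map_zero C)
      rw [← hP (m + 1) (Nat.le_add_left 1 m)]
      push_cast
      ring_nf
    · have hne := shiftElim_ne_zero h0
      have hlt := (natDegree_lt_iff_degree_lt hne).2 (degree_shiftElim_lt P)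
      refine absurd (ih _ hlt (shiftElim P) (fun n hn => ?_) rfl) hne
      have hn1 : (n : F) + 1 ≠ 0 := by exact_mod_cast n.succ_ne_zero
      have h1 := hP (n + 1) (Nat.le_add_left 1 n)
      push_cast at h1
      rw [shiftElim, evalEval_sub, evalEval_mul, evalEval_mul, hP n hn,
        evalEval_shiftClear P hn1 (hu n), h1]
      simp

theorem mainTheorem9 :
    IsTranscendentalFunction algebraicNumbers baselPartialSum := by
  rintro ⟨k, q, hqk, hrel⟩
  set P : ℂ[X][X] := ∑ i ∈ Finset.range (k + 1),
    C ((q i).map (algebraMap algebraicNumbers ℂ)) * X ^ i with hPdef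
  have hP : P = 0 := by
    refine eq_zero_of_evalEval_eq_zero
      (u := fun n => ∑ j ∈ Finset.Icc 1 n, 1 / (j : ℂ) ^ 2) (fun n => ?_) P (fun n hn => ?_)
    · simp [Finset.sum_Icc_succ_top]
    · have h := hrel ⟨n, hn⟩
      simp only [baselPartialSum, PNat.mk_coe] at h
      rw [← h, hPdef, evalEval_finsetSum]
      refine Finset.sum_congr rfl fun i _ => ?_
      rw [evalEval_mul, evalEval_pow, evalEval_C, evalEval_X, eval_map_algebraMap]
  refine hqk ((Polynomial.map_eq_zero (algebraMap algebraicNumbers ℂ)).1 ?_)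
  have h := congrArg (fun Q => Q.coeff k) hP
  simpa [hPdef, finsetSum_coeff, coeff_X_pow] using h
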